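/- Let $c,r,\mu,\sigma,\sigma_1,\lambda,m>0$ and $|\rho|<1$ be constants with $\mu\neq r$, and let $F$ be the exponential distribution with mean $m$. They describe an insurer with premium rate $c$, claims arriving at rate $\lambda$ with distribution $F$, Brownian perturbation of volatility $\sigma_1$, interest rate $r$, and a stock with return $\mu$ and volatility $\sigma$, where $\rho$ is the correlation of the two Brownian motions and any amount $a\in\mathbb R$ may be invested in the stock. For $a\in\mathbb R$ put $$\mathcal L^{(a)}V(x)=\tfrac12(\sigma^2a^2+2\rho\sigma\sigma_1a+\sigma_1^2)V''(x)+[c+(\mu-r)a+rx]V'(x)-\lambda\Big[V(x)-\int_0^xV(x-s)\,dF(s)\Big].$$ The Hamilton–Jacobi–Bellman equation of ruin probability minimization, $\sup_{a\in\mathbb R}\mathcal L^{(a)}V(x)=0$ for $x>0$, has a solution $V$, continuous on $[0,\infty)$ and twice continuously differentiable on $(0,\infty)$, with $V'>0$ and $V''<0$ on $(0,\infty)$, $V(0)=0$ and $V'(0+)=1$. For every such $V$ and every $x>0$ the unique maximizer of $a\mapsto\mathcal L^{(a)}V(x)$, called the optimal investment at surplus $x$, is $$a^*_V(x)=-\frac{(\mu-r)V'(x)}{\sigma^2V''(x)}-\rho\frac{\sigma_1}{\sigma},$$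 and, as $x\to\infty$, $$a^*_V(x)=\frac{(\mu-r)m}{\sigma^2}-\rho\frac{\sigma_1}{\sigma}-\Big(1-\frac{\lambda}{r}\Big)\frac{(\mu-r)m^2}{\sigma^2}\,\frac1x+o\Big(\frac1x\Big).$$ In particular $a^*_V(x)$ tends to the finite limit $\frac{(\mu-r)m}{\sigma^2}-\rho\frac{\sigma_1}{\sigma}$, and if $\lambda\neq r$ then $$a^*_V(x)=\frac{(\mu-r)m}{\sigma^2}-\rho\frac{\sigma_1}{\sigma}-\Big(1-\frac{\lambda}{r}\Big)\frac{(\mu-r)m^2}{\sigma^2}\,\frac1x\,(1+o(1)).$$ -/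

import Mathlib

open Set Filter Topology Asymptotics MeasureTheory

noncomputable section

/-- Coefficients of the perturbed Cramér–Lundberg surplus with investment: premium rate `c`,
interest rate `r`, stock return `μ`, stock volatility `σ`, perturbation volatility `σ₁`,
correlation `ρ` of the two Brownian motions, claim intensity `lam`. -/
structure SurplusModel where
  c : ℝ
  r : ℝ
  μ : ℝ
  σ : ℝ
  σ₁ : ℝ
  ρ : ℝ
  lam : ℝ

namespace SurplusModel

/-- The jump part `M(W)(x) = λ [W(x) - ∫₀ˣ W(x - s) dF(s)]`, for a claim distribution `F`
carried by `(0, ∞)`. -/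
def jumpTerm (P : SurplusModel) (F : Measure ℝ) (W : ℝ → ℝ) (x : ℝ) : ℝ :=
  P.lam * (W x - ∫ s in Ioc 0 x, W (x - s) ∂F)

/-- The controlled generator
`L^(a) W(x) = ½(σ²a² + 2ρσσ₁a + σ₁²) W''(x) + [c + (μ - r)a + rx] W'(x) - M(W)(x)`. -/
def generator (P : SurplusModel) (F : Measure ℝ) (a : ℝ) (W : ℝ → ℝ) (x : ℝ) : ℝ :=
  (1 / 2) * (P.σ ^ 2 * a ^ 2 + 2 * P.ρ * P.σ * P.σ₁ * a + P.σ₁ ^ 2) * deriv (deriv W) x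
    + (P.c + (P.μ - P.r) * a + P.r * x) * deriv W x - P.jumpTerm F W x

/-- `W` is a classical, increasing and concave solution on `(0, ∞)` of the HJB equation
`sup_{a ∈ ℝ} L^(a) W(x) = 0` of unconstrained investment, with `W(0) = 0` and `W'(0+) = 1`. -/
structure IsHJBSolution (P : SurplusModel) (F : Measure ℝ) (W : ℝ → ℝ) : Prop where
  contDiffOn : ContDiffOn ℝ 2 W (Ioi 0)
  continuousOn : ContinuousOn W (Ici 0)
  deriv_pos : ∀ x, 0 < x → 0 < deriv W x
  deriv_deriv_neg : ∀ x, 0 < x → deriv (deriv W) x < 0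
  zero : W 0 = 0
  deriv_zero_right : Tendsto (deriv W) (𝓝[>] 0) (𝓝 1)
  hjb : ∀ x, 0 < x → IsLUB (range fun a : ℝ => P.generator F a W x) 0

/-- The optimal unconstrained investment at surplus `x`,
`a*_W(x) = -(μ - r)W'(x) / (σ²W''(x)) - ρσ₁/σ`. -/
def optimalInvestment (P : SurplusModel) (W : ℝ → ℝ) (x : ℝ) : ℝ :=
  -((P.μ - P.r) * deriv W x) / (P.σ ^ 2 * deriv (deriv W) x) - P.ρ * (P.σ₁ / P.σ)

/-- The limit `(μ - r)m/σ² - ρσ₁/σ` for exponential claims of mean `m`. -/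
def limitInvestment (P : SurplusModel) (m : ℝ) : ℝ :=
  (P.μ - P.r) * m / P.σ ^ 2 - P.ρ * (P.σ₁ / P.σ)

/-- The coefficient `(1 - λ/r)(μ - r)m²/σ²` of `-1/x` for exponential claims of mean `m`. -/
def rateCoeff (P : SurplusModel) (m : ℝ) : ℝ :=
  (1 - P.lam / P.r) * ((P.μ - P.r) * m ^ 2 / P.σ ^ 2)

end SurplusModel

end

/-!
Maximizing over `a` turns the HJB equation into a relation between the risk aversion
`w = -V'' / V'`, of which the optimal investment is the affine function
`(μ - r) / (σ² w) - ρ σ₁ / σ` of `1 / w`, and the expected drop of `V` at a claim in units of `V'`,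
called `h`. For exponential claims of rate `η = 1 / m` this is the first order system
`A w - R / w = k + r x - λ h`, `h' = 1 + h (w - η)`.

Asymptotics: compare `w` with the curves `η + c / x`. Where `w` meets such a curve, the drift
`A w - R / w` moves relative to it at a speed tending to `r - λ - c r`, so for large `x` all
crossings have the same direction, downward if `c > 1 - λ / r` and upward if `c < 1 - λ / r`.
If `w` stayed forever on the side it can only leave, the differential inequality for `h` would make
`λ h` grow linearly faster (slower) than `r x`, contradicting the first equation. Hence
`x (w - η) → 1 - λ / r`.

Existence: `g = λ h exp (η x)` satisfies an equation whose right-hand side is bounded and Lipschitz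
in `g`, uniformly for bounded `x`, so it has a global solution; `V` is then the utility function
with risk aversion `w`.
-/

/-- The drift `β` for which `w` solves the Riccati equation `A w² - β w - R = 0`. -/
noncomputable def riccatiDrift (A R w : ℝ) : ℝ := A * w - R / w

/-- The positive solution `w` of the Riccati equation `A w² - β w - R = 0`, which inverts
`riccatiDrift A R` on the positive half-line. -/
noncomputable def riccatiRoot (A R β : ℝ) : ℝ := (β + √(β ^ 2 + 4 * A * R)) / (2 * A)

section Riccati

variable {A R : ℝ}

theorem hasDerivAt_riccatiDrift {w : ℝ} (hw : w ≠ 0) :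
    HasDerivAt (riccatiDrift A R) (A + R / w ^ 2) w := by
  refine (((hasDerivAt_id w).const_mul A).sub ((hasDerivAt_inv hw).const_mul R)).congr_deriv ?_
  ring

theorem riccatiDrift_sub_riccatiDrift {w₁ w₂ : ℝ} (h₁ : w₁ ≠ 0) (h₂ : w₂ ≠ 0) :
    riccatiDrift A R w₁ - riccatiDrift A R w₂ = (w₁ - w₂) * (A + R / (w₁ * w₂)) := by
  unfold riccatiDrift
  field_simp
  ring

theorem strictMonoOn_riccatiDrift (hA : 0 < A) (hR : 0 ≤ R) :
    StrictMonoOn (riccatiDrift A R) (Ioi 0) := by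
  intro w₁ (h₁ : 0 < w₁) w₂ (h₂ : 0 < w₂) hlt
  have hsub : 0 < (w₂ - w₁) * (A + R / (w₂ * w₁)) := mul_pos (sub_pos.2 hlt) (by positivity)
  rwa [← riccatiDrift_sub_riccatiDrift h₂.ne' h₁.ne', sub_pos] at hsub

theorem riccatiRoot_pos (hA : 0 < A) (hR : 0 < R) (β : ℝ) : 0 < riccatiRoot A R β := by
  have hlt : |β| < √(β ^ 2 + 4 * A * R) := by
    rw [← Real.sqrt_sq_eq_abs]
    exact Real.sqrt_lt_sqrt (sq_nonneg β) (lt_add_of_pos_right _ (by positivity))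
  exact div_pos (by linarith [neg_abs_le β]) (by positivity)

theorem riccatiDrift_riccatiRoot (hA : 0 < A) (hR : 0 < R) (β : ℝ) :
    riccatiDrift A R (riccatiRoot A R β) = β := by
  have hsq : √(β ^ 2 + 4 * A * R) ^ 2 = β ^ 2 + 4 * A * R := Real.sq_sqrt (by positivity)
  have hroot : A * riccatiRoot A R β ^ 2 - β * riccatiRoot A R β - R = 0 := by
    unfold riccatiRoot
    generalize √(β ^ 2 + 4 * A * R) = s at hsq
    field_simp
    linear_combination hsq
  have hpos := riccatiRoot_pos hA hR β
  unfold riccatiDrift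
  field_simp
  linear_combination hroot

theorem monotone_riccatiRoot (hA : 0 < A) (hR : 0 < R) : Monotone (riccatiRoot A R) := by
  intro β₁ β₂ hle
  rw [← riccatiDrift_riccatiRoot hA hR β₁, ← riccatiDrift_riccatiRoot hA hR β₂] at hle
  exact ((strictMonoOn_riccatiDrift hA hR.le).le_iff_le (riccatiRoot_pos hA hR β₁)
    (riccatiRoot_pos hA hR β₂)).1 hle

theorem continuous_riccatiRoot : Continuous (riccatiRoot A R) := by
  unfold riccatiRoot
  fun_prop

theorem mul_abs_riccatiRoot_sub_le (hA : 0 < A) (hR : 0 < R) (β₁ β₂ : ℝ) :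
    A * |riccatiRoot A R β₁ - riccatiRoot A R β₂| ≤ |β₁ - β₂| := by
  have h₁ := riccatiRoot_pos hA hR β₁
  have h₂ := riccatiRoot_pos hA hR β₂
  have hsub := riccatiDrift_sub_riccatiDrift (A := A) (R := R) h₁.ne' h₂.ne'
  rw [riccatiDrift_riccatiRoot hA hR, riccatiDrift_riccatiRoot hA hR] at hsub
  have hA_le : A ≤ A + R / (riccatiRoot A R β₁ * riccatiRoot A R β₂) :=
    le_add_of_nonneg_right (by positivity)
  rw [hsub, abs_mul, abs_of_pos (hA.trans_le hA_le), mul_comm]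
  gcongr

end Riccati

theorem eventually_nonpos_of_deriv_neg_of_eq_zero {f f' : ℝ → ℝ}
    (hf : ∀ᶠ x in atTop, HasDerivAt f (f' x) x) (hfreq : ∃ᶠ x in atTop, f x ≤ 0)
    (hneg : ∀ᶠ x in atTop, f x = 0 → f' x < 0) : ∀ᶠ x in atTop, f x ≤ 0 := by
  obtain ⟨X, hX⟩ := eventually_atTop.1 (hf.and hneg)
  obtain ⟨y, hXy, hy⟩ := frequently_atTop.1 hfreq X
  have hderiv : ∀ x, y ≤ x → HasDerivAt f (f' x) x := fun x hx => (hX x (hXy.trans hx)).1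
  filter_upwards [eventually_ge_atTop y] with z hz
  exact image_le_of_deriv_right_lt_deriv_boundary (B := fun _ => 0) (B' := fun _ => 0)
    (fun x hx => (hderiv x hx.1).continuousAt.continuousWithinAt)
    (fun x hx => (hderiv x hx.1).hasDerivWithinAt) hy (fun x => hasDerivAt_const x 0)
    (fun x hx => (hX x (hXy.trans hx.1)).2) ⟨hz, le_rfl⟩

theorem eventually_nonneg_of_deriv_pos_of_eq_zero {f f' : ℝ → ℝ}
    (hf : ∀ᶠ x in atTop, HasDerivAt f (f' x) x) (hfreq : ∃ᶠ x in atTop, 0 ≤ f x)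
    (hpos : ∀ᶠ x in atTop, f x = 0 → 0 < f' x) : ∀ᶠ x in atTop, 0 ≤ f x := by
  have hle := eventually_nonpos_of_deriv_neg_of_eq_zero (hf.mono fun _ hx => hx.neg)
    (by simpa using hfreq) (by simpa using hpos)
  simpa using hle

/-- `a x / (1 - c)` solves the equation `y' = a + c y / x`, and `x ^ c` the homogeneous one. -/
theorem monotoneOn_sub_mul_mul_rpow_neg {h h' : ℝ → ℝ} {a c X : ℝ} (hc : c ≠ 1) (hX : 0 < X)
    (hderiv : ∀ x, X ≤ x → HasDerivAt h (h' x) x)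
    (hle : ∀ x, X ≤ x → a + c * (h x / x) ≤ h' x) :
    MonotoneOn (fun x => (h x - a / (1 - c) * x) * x ^ (-c)) (Ici X) := by
  have hc' : 1 - c ≠ 0 := sub_ne_zero.2 hc.symm
  have hG : ∀ x, X ≤ x → HasDerivAt (fun x => (h x - a / (1 - c) * x) * x ^ (-c))
      ((h' x - a - c * (h x / x)) * x ^ (-c)) x := by
    intro x hx
    have hx0 : x ≠ 0 := (hX.trans_le hx).ne'
    refine (((hderiv x hx).sub ((hasDerivAt_id x).const_mul (a / (1 - c)))).mul
      (Real.hasDerivAt_rpow_const (p := -c) (Or.inl hx0))).congr_deriv ?_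
    rw [Real.rpow_sub_one hx0]
    simp only [id_eq, Pi.sub_apply]
    field_simp
    ring
  refine monotoneOn_of_deriv_nonneg (convex_Ici X)
    (fun x hx => (hG x hx).continuousAt.continuousWithinAt)
    (fun x hx => (hG x (interior_subset hx)).differentiableAt.differentiableWithinAt)
    fun x hx => ?_
  have hXx : X ≤ x := interior_subset hx
  rw [(hG x hXx).deriv]
  exact mul_nonneg (by linarith [hle x hXx]) (Real.rpow_nonneg (hX.trans_le hXx).le _)

theorem eventually_mul_le_of_add_mul_div_le_deriv {h h' : ℝ → ℝ} {a c d : ℝ} (hc : c < 1)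
    (hd : d * (1 - c) < a) (hderiv : ∀ᶠ x in atTop, HasDerivAt h (h' x) x)
    (hle : ∀ᶠ x in atTop, a + c * (h x / x) ≤ h' x) : ∀ᶠ x in atTop, d * x ≤ h x := by
  have hc' : 0 < 1 - c := sub_pos.2 hc
  obtain ⟨X, hX⟩ := eventually_atTop.1 ((hderiv.and hle).and (eventually_gt_atTop 0))
  have hmono := monotoneOn_sub_mul_mul_rpow_neg hc.ne (hX X le_rfl).2 (fun x hx => (hX x hx).1.1)
    fun x hx => (hX x hx).1.2
  let b := (h X - a / (1 - c) * X) * X ^ (-c)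
  have hlim : Tendsto (fun x => a / (1 - c) + b * x ^ (-(1 - c))) atTop
      (𝓝 (a / (1 - c) + b * 0)) :=
    ((tendsto_rpow_neg_atTop hc').const_mul b).const_add _
  have hd' : d < a / (1 - c) + b * 0 := by rwa [mul_zero, add_zero, lt_div_iff₀ hc']
  filter_upwards [hlim.eventually_const_lt hd', eventually_ge_atTop X] with x hdx hx
  have hx0 : 0 < x := (hX x hx).2
  have hpow : x ^ (-(1 - c)) * x = x ^ c := by
    rw [← Real.rpow_add_one hx0.ne']
    congr 1
    ring
  have hbx : b * x ^ c ≤ h x - a / (1 - c) * x := by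
    rw [← le_div_iff₀ (Real.rpow_pos_of_pos hx0 c), div_eq_mul_inv, ← Real.rpow_neg hx0.le]
    exact hmono self_mem_Ici hx hx
  calc d * x ≤ (a / (1 - c) + b * x ^ (-(1 - c))) * x := by gcongr
    _ = a / (1 - c) * x + b * x ^ c := by rw [add_mul, mul_assoc, hpow]
    _ ≤ h x := by linarith

theorem exists_eq_mul_exp_mul_of_relaxation {f p : ℝ → ℝ} {η x : ℝ} (hx : 0 < x)
    (hf : ContinuousOn f (Icc 0 x)) (hf₀ : f 0 = 0)
    (hf' : ∀ y ∈ Ioo 0 x, HasDerivAt f (p y - η * f y) y) :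
    ∃ y ∈ Ioo 0 x, f x = x * Real.exp (η * (y - x)) * p y := by
  have hexp : ∀ y, HasDerivAt (fun y => Real.exp (η * y)) (Real.exp (η * y) * (η * 1)) y :=
    fun y => ((hasDerivAt_id y).const_mul η).exp
  obtain ⟨y, hy, hslope⟩ := exists_hasDerivAt_eq_slope (fun y => Real.exp (η * y) * f y)
    (fun y => Real.exp (η * y) * p y) hx (by fun_prop)
    fun y hy => ((hexp y).mul (hf' y hy)).congr_deriv (by ring)
  rw [hf₀, mul_zero, sub_zero, sub_zero, eq_div_iff hx.ne'] at hslope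
  refine ⟨y, hy, ?_⟩
  rw [mul_sub, Real.exp_sub, mul_div_assoc', div_mul_eq_mul_div, eq_div_iff (Real.exp_ne_zero _)]
  linear_combination -hslope

section FirstOrderExpansion

variable {f : ℝ → ℝ} {l b : ℝ}

theorem tendsto_of_tendsto_mul_sub (hf : Tendsto (fun x => x * (f x - l)) atTop (𝓝 b)) :
    Tendsto f atTop (𝓝 l) := by
  have hlim := (hf.mul tendsto_inv_atTop_zero).add_const l
  rw [mul_zero, zero_add] at hlim
  refine hlim.congr' ?_
  filter_upwards [eventually_ne_atTop 0] with x hx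
  field_simp
  ring

theorem isLittleO_sub_of_tendsto_mul_sub (hf : Tendsto (fun x => x * (f x - l)) atTop (𝓝 (-b))) :
    (fun x => f x - (l - b * (1 / x))) =o[atTop] fun x => 1 / x := by
  have hlim := hf.add_const b
  rw [neg_add_cancel] at hlim
  refine (isLittleO_iff_tendsto' ?_).2 (hlim.congr' ?_)
  · filter_upwards [eventually_ne_atTop 0] with x hx hx'
    exact absurd hx' (one_div_ne_zero hx)
  · filter_upwards [eventually_ne_atTop 0] with x hx
    field_simp
    ring

theorem exists_eq_sub_mul_one_add_of_tendsto_mul_sub (hb : b ≠ 0)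
    (hf : Tendsto (fun x => x * (f x - l)) atTop (𝓝 (-b))) :
    ∃ ε : ℝ → ℝ, Tendsto ε atTop (𝓝 0) ∧
      ∀ x, 0 < x → f x = l - b * (1 / x) * (1 + ε x) := by
  refine ⟨fun x => x * (f x - l) / -b - 1, ?_, fun x hx => ?_⟩
  · simpa [hb] using (hf.div_const (-b)).sub_const 1
  · field_simp
    ring

end FirstOrderExpansion

/-- The HJB equation with exponential claims of rate `η`, reduced to first order: `w` stands for
the risk aversion `-V'' / V'`, and `h` for the expected drop `V - E[V(x - S); S ≤ x]` of the value
function at a claim `S`, in units of `V'`. -/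
structure IsReducedSolution (A R k r lam η : ℝ) (w h : ℝ → ℝ) : Prop where
  pos_left : ∀ x, 0 < x → 0 < w x
  pos_right : ∀ x, 0 < x → 0 < h x
  riccatiDrift_eq : ∀ x, 0 < x → riccatiDrift A R (w x) = k + r * x - lam * h x
  hasDerivAt_right : ∀ x, 0 < x → HasDerivAt h (1 + h x * (w x - η)) x

section ReducedAsymptotics

variable {A R k r lam η c : ℝ} {w h : ℝ → ℝ}

theorem tendsto_const_add_div_atTop (l c : ℝ) : Tendsto (fun x : ℝ => l + c / x) atTop (𝓝 l) := by
  have hdiv : Tendsto (fun x : ℝ => c / x) atTop (𝓝 0) := tendsto_const_nhds.div_atTop tendsto_id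
  simpa using hdiv.const_add l

theorem tendsto_riccatiDrift_add_div (A R c : ℝ) (hη : η ≠ 0) :
    Tendsto (fun x => riccatiDrift A R (η + c / x)) atTop (𝓝 (riccatiDrift A R η)) :=
  (hasDerivAt_riccatiDrift hη).continuousAt.tendsto.comp (tendsto_const_add_div_atTop η c)

theorem eventually_add_div_pos (hη : 0 < η) : ∀ᶠ x in atTop, 0 < η + c / x :=
  (tendsto_const_add_div_atTop η c).eventually_const_lt hη

theorem tendsto_crossing_speed (A R k r lam c : ℝ) (hη : η ≠ 0) :
    Tendsto (fun x => r - lam - c * ((k + r * x - riccatiDrift A R (η + c / x)) / x)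
      + (A + R / (η + c / x) ^ 2) * (c / x ^ 2)) atTop (𝓝 (r - lam - c * r)) := by
  have hratio : Tendsto (fun x => (k + r * x - riccatiDrift A R (η + c / x)) / x) atTop
      (𝓝 (r + 0)) := by
    refine ((((tendsto_riccatiDrift_add_div A R c hη).const_sub
      k).div_atTop tendsto_id).const_add r).congr' ?_
    filter_upwards [eventually_gt_atTop 0] with x hx
    simp only [id_eq]
    field_simp
    ring
  have hslope : Tendsto (fun x => (A + R / (η + c / x) ^ 2) * (c / x ^ 2)) atTop
      (𝓝 ((A + R / η ^ 2) * 0)) :=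
    ((tendsto_const_nhds.div ((tendsto_const_add_div_atTop η c).pow 2)
      (by positivity)).const_add A).mul
      (tendsto_const_nhds.div_atTop (tendsto_pow_atTop two_ne_zero))
  simpa using ((hratio.const_mul c).const_sub (r - lam)).add hslope

namespace IsReducedSolution

theorem hasDerivAt_drift_sub_riccatiDrift (hS : IsReducedSolution A R k r lam η w h) {x : ℝ}
    (hx : 0 < x) (hv : η + c / x ≠ 0) :
    HasDerivAt (fun x => k + r * x - lam * h x - riccatiDrift A R (η + c / x))
      (r - lam * (1 + h x * (w x - η)) + (A + R / (η + c / x) ^ 2) * (c / x ^ 2)) x := by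
  have hcurve : HasDerivAt (fun x => η + c / x) (-(c / x ^ 2)) x := by
    refine (((hasDerivAt_inv hx.ne').const_mul c).const_add η).congr_deriv ?_
    ring
  have hline : HasDerivAt (fun x => k + r * x) r x := by
    simpa using ((hasDerivAt_id x).const_mul r).const_add k
  refine ((hline.sub ((hS.hasDerivAt_right x hx).const_mul lam)).sub
    ((hasDerivAt_riccatiDrift hv).comp x hcurve)).congr_deriv ?_
  ring

theorem deriv_eq_of_crossing (hS : IsReducedSolution A R k r lam η w h) (hA : 0 < A) (hR : 0 ≤ R)
    {x : ℝ} (hx : 0 < x) (hv : 0 < η + c / x)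
    (hcross : k + r * x - lam * h x - riccatiDrift A R (η + c / x) = 0) :
    lam * (1 + h x * (w x - η)) =
      lam + c * ((k + r * x - riccatiDrift A R (η + c / x)) / x) := by
  have hw : w x = η + c / x := by
    refine (strictMonoOn_riccatiDrift hA hR).injOn (hS.pos_left x hx) hv ?_
    rw [hS.riccatiDrift_eq x hx]
    linarith
  rw [hw, ← (by linarith : lam * h x = k + r * x - riccatiDrift A R (η + c / x))]
  ring

theorem frequently_drift_le (hS : IsReducedSolution A R k r lam η w h) (hA : 0 < A) (hR : 0 ≤ R)
    (hr : 0 < r) (hlam : 0 < lam) (hη : 0 < η) (hc : 1 - lam / r < c) (hc₁ : c < 1) :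
    ∃ᶠ x in atTop, k + r * x - lam * h x - riccatiDrift A R (η + c / x) ≤ 0 := by
  intro hgt
  simp only [not_le, sub_pos] at hgt
  have hc' : 0 < 1 - c := sub_pos.2 hc₁
  obtain ⟨d, hrd, hd⟩ : ∃ d, r / lam < d ∧ d < 1 / (1 - c) := by
    refine exists_between ?_
    rw [div_lt_div_iff₀ hlam hc', one_mul, mul_comm, ← lt_div_iff₀ hr]
    linarith
  rw [div_lt_iff₀ hlam] at hrd
  rw [lt_div_iff₀ hc'] at hd
  have hgrowth : ∀ᶠ x in atTop, d * x ≤ h x := by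
    refine eventually_mul_le_of_add_mul_div_le_deriv hc₁ hd
      ((eventually_gt_atTop 0).mono hS.hasDerivAt_right) ?_
    filter_upwards [hgt, eventually_gt_atTop 0, eventually_add_div_pos hη] with x hgtx hx hv
    rw [← hS.riccatiDrift_eq x hx,
      (strictMonoOn_riccatiDrift hA hR).lt_iff_lt hv (hS.pos_left x hx)] at hgtx
    have := mul_le_mul_of_nonneg_left hgtx.le (hS.pos_right x hx).le
    linear_combination this
  have hbot : Tendsto (fun x => (r - d * lam) * x + (k - riccatiDrift A R (η + c / x))) atTop
      atBot :=
    (tendsto_id.const_mul_atTop_of_neg (by linarith)).atBot_add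
      ((tendsto_riccatiDrift_add_div A R c hη.ne').const_sub k)
  obtain ⟨x, hgtx, hdx, hneg⟩ := (hgt.and (hgrowth.and (hbot.eventually_lt_atBot 0))).exists
  linarith [mul_le_mul_of_nonneg_left hdx hlam.le]

theorem frequently_le_drift (hS : IsReducedSolution A R k r lam η w h) (hA : 0 < A) (hR : 0 ≤ R)
    (hr : 0 < r) (hlam : 0 < lam) (hη : 0 < η) (hc : c < 1 - lam / r) :
    ∃ᶠ x in atTop, 0 ≤ k + r * x - lam * h x - riccatiDrift A R (η + c / x) := by
  intro hlt
  simp only [not_le, sub_neg] at hlt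
  have hc₁ : c < 1 := hc.trans (sub_lt_self 1 (div_pos hlam hr))
  have hc' : 0 < 1 - c := sub_pos.2 hc₁
  obtain ⟨d, hd, hrd⟩ : ∃ d, 1 / (1 - c) < d ∧ d < r / lam := by
    refine exists_between ?_
    rw [div_lt_div_iff₀ hc' hlam, one_mul, mul_comm, ← div_lt_iff₀ hr]
    linarith
  rw [lt_div_iff₀ hlam] at hrd
  rw [div_lt_iff₀ hc'] at hd
  have hgrowth : ∀ᶠ x in atTop, -d * x ≤ -h x := by
    refine eventually_mul_le_of_add_mul_div_le_deriv (a := -1) hc₁ (by linarith)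
      ((eventually_gt_atTop 0).mono fun x hx => (hS.hasDerivAt_right x hx).neg) ?_
    filter_upwards [hlt, eventually_gt_atTop 0, eventually_add_div_pos hη] with x hltx hx hv
    rw [← hS.riccatiDrift_eq x hx,
      (strictMonoOn_riccatiDrift hA hR).lt_iff_lt (hS.pos_left x hx) hv] at hltx
    have := mul_le_mul_of_nonneg_left hltx.le (hS.pos_right x hx).le
    linear_combination this
  have htop : Tendsto (fun x => (r - d * lam) * x + (k - riccatiDrift A R (η + c / x))) atTop
      atTop :=
    (tendsto_id.const_mul_atTop (by linarith)).atTop_add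
      ((tendsto_riccatiDrift_add_div A R c hη.ne').const_sub k)
  obtain ⟨x, hltx, hdx, hpos⟩ := (hlt.and (hgrowth.and (htop.eventually_gt_atTop 0))).exists
  linarith [mul_le_mul_of_nonneg_left hdx hlam.le]

theorem eventually_le_add_div (hS : IsReducedSolution A R k r lam η w h) (hA : 0 < A)
    (hR : 0 ≤ R) (hr : 0 < r) (hlam : 0 < lam) (hη : 0 < η) (hc : 1 - lam / r < c) (hc₁ : c < 1) :
    ∀ᶠ x in atTop, w x ≤ η + c / x := by
  have hx := eventually_gt_atTop (0 : ℝ)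
  have hv := eventually_add_div_pos (c := c) hη
  have hspeed : r - lam - c * r < 0 := by
    field_simp at hc
    linarith
  have hle := eventually_nonpos_of_deriv_neg_of_eq_zero
    ((hx.and hv).mono fun x hxv => hS.hasDerivAt_drift_sub_riccatiDrift hxv.1 hxv.2.ne')
    (hS.frequently_drift_le hA hR hr hlam hη hc hc₁) <| by
      have hlim := tendsto_crossing_speed A R k r lam c hη.ne'
      filter_upwards [hx, hv, hlim.eventually_lt_const hspeed] with x hx hv hneg hcross
      rw [hS.deriv_eq_of_crossing hA hR hx hv hcross]
      linarith
  filter_upwards [hle, hx, hv] with x hle hx hv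
  rwa [← hS.riccatiDrift_eq x hx, sub_nonpos,
    (strictMonoOn_riccatiDrift hA hR).le_iff_le (hS.pos_left x hx) hv] at hle

theorem eventually_add_div_le (hS : IsReducedSolution A R k r lam η w h) (hA : 0 < A)
    (hR : 0 ≤ R) (hr : 0 < r) (hlam : 0 < lam) (hη : 0 < η) (hc : c < 1 - lam / r) :
    ∀ᶠ x in atTop, η + c / x ≤ w x := by
  have hx := eventually_gt_atTop (0 : ℝ)
  have hv := eventually_add_div_pos (c := c) hη
  have hspeed : 0 < r - lam - c * r := by
    field_simp at hc
    linarith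
  have hge := eventually_nonneg_of_deriv_pos_of_eq_zero
    ((hx.and hv).mono fun x hxv => hS.hasDerivAt_drift_sub_riccatiDrift hxv.1 hxv.2.ne')
    (hS.frequently_le_drift hA hR hr hlam hη hc) <| by
      have hlim := tendsto_crossing_speed A R k r lam c hη.ne'
      filter_upwards [hx, hv, hlim.eventually_const_lt hspeed] with x hx hv hpos hcross
      rw [hS.deriv_eq_of_crossing hA hR hx hv hcross]
      linarith
  filter_upwards [hge, hx, hv] with x hge hx hv
  rwa [← hS.riccatiDrift_eq x hx, sub_nonneg,
    (strictMonoOn_riccatiDrift hA hR).le_iff_le hv (hS.pos_left x hx)] at hge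

theorem tendsto_mul_sub (hS : IsReducedSolution A R k r lam η w h) (hA : 0 < A)
    (hR : 0 ≤ R) (hr : 0 < r) (hlam : 0 < lam) (hη : 0 < η) :
    Tendsto (fun x => x * (w x - η)) atTop (𝓝 (1 - lam / r)) := by
  refine tendsto_order.2 ⟨fun b hb => ?_, fun b hb => ?_⟩
  · obtain ⟨c, hbc, hc⟩ := exists_between hb
    filter_upwards [hS.eventually_add_div_le hA hR hr hlam hη hc, eventually_gt_atTop 0]
      with x hle hx
    have hcx : c / x ≤ w x - η := by linarith
    rw [div_le_iff₀' hx] at hcx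
    exact hbc.trans_le hcx
  · obtain ⟨c, hc, hcb⟩ := exists_between (lt_min hb (sub_lt_self 1 (div_pos hlam hr)))
    filter_upwards [hS.eventually_le_add_div hA hR hr hlam hη hc (hcb.trans_le
      (min_le_right _ _)), eventually_gt_atTop 0] with x hle hx
    have hcx : w x - η ≤ c / x := by linarith
    rw [le_div_iff₀' hx] at hcx
    exact hcx.trans_lt (hcb.trans_le (min_le_left _ _))

end IsReducedSolution

end ReducedAsymptotics

section GlobalODE

variable {E : Type*} [NormedAddCommGroup E] [NormedSpace ℝ E] [CompleteSpace E] {v : ℝ → E → E}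

theorem exists_hasDerivAt_Ioo_of_bounded_lipschitz {T : ℝ} (hT : 0 < T) {K L : NNReal}
    (hcont : ∀ y, ContinuousOn (fun t => v t y) (Icc (-T) T))
    (hlip : ∀ t ∈ Icc (-T) T, LipschitzWith K (v t))
    (hbdd : ∀ t ∈ Icc (-T) T, ∀ y, ‖v t y‖ ≤ L) (y₀ : E) :
    ∃ α : ℝ → E, α 0 = y₀ ∧ ∀ t ∈ Ioo (-T) T, HasDerivAt α (v t (α t)) t := by
  have h0 : (0 : ℝ) ∈ Icc (-T) T := ⟨(neg_lt_zero.2 hT).le, hT.le⟩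
  lift T to NNReal using hT.le
  have hpl : IsPicardLindelof v (⟨0, h0⟩ : Icc (-(T : ℝ)) T) y₀ (L * T) 0 L K :=
    { lipschitzOnWith := fun t ht => (hlip t ht).lipschitzOnWith
      continuousOn := fun y _ => hcont y
      norm_le := fun t ht y _ => hbdd t ht y
      mul_max_le := by simp }
  obtain ⟨α, hα₀, hα⟩ := hpl.exists_eq_forall_mem_Icc_hasDerivWithinAt₀
  exact ⟨α, hα₀, fun t ht =>
    (hα t (Ioo_subset_Icc_self ht)).hasDerivAt (Icc_mem_nhds ht.1 ht.2)⟩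

theorem exists_isIntegralCurve_of_bounded_lipschitz (hcont : ∀ y, Continuous fun t => v t y)
    (hlip : ∀ T : ℝ, ∃ K : NNReal, ∀ t ∈ Icc (-T) T, LipschitzWith K (v t))
    (hbdd : ∀ T : ℝ, ∃ L : NNReal, ∀ t ∈ Icc (-T) T, ∀ y, ‖v t y‖ ≤ L) (y₀ : E) :
    ∃ g : ℝ → E, g 0 = y₀ ∧ IsIntegralCurve g v := by
  have hlocal : ∀ n : ℕ, ∃ α : ℝ → E, α 0 = y₀ ∧
      ∀ t ∈ Ioo (-(n + 1 : ℝ)) (n + 1), HasDerivAt α (v t (α t)) t := fun n => by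
    obtain ⟨K, hK⟩ := hlip (n + 1)
    obtain ⟨L, hL⟩ := hbdd (n + 1)
    exact exists_hasDerivAt_Ioo_of_bounded_lipschitz n.cast_add_one_pos
      (fun y => (hcont y).continuousOn) hK hL y₀
  choose α hα₀ hα using hlocal
  have hagree : ∀ {k n : ℕ}, k ≤ n → EqOn (α k) (α n) (Ioo (-(k + 1 : ℝ)) (k + 1)) := by
    intro k n hkn
    obtain ⟨K, hK⟩ := hlip (k + 1)
    have hsub : Ioo (-(k + 1 : ℝ)) (k + 1) ⊆ Ioo (-(n + 1 : ℝ)) (n + 1) :=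
      Ioo_subset_Ioo (by gcongr) (by gcongr)
    have h0 : (0 : ℝ) ∈ Ioo (-(k + 1 : ℝ)) (k + 1) :=
      ⟨neg_lt_zero.2 k.cast_add_one_pos, k.cast_add_one_pos⟩
    exact ODE_solution_unique_of_mem_Ioo (s := fun _ => univ)
      (fun t ht => (hK t (Ioo_subset_Icc_self ht)).lipschitzOnWith) h0
      (fun t ht => ⟨hα k t ht, mem_univ _⟩) (fun t ht => ⟨hα n t (hsub ht), mem_univ _⟩)
      ((hα₀ k).trans (hα₀ n).symm)
  let g : ℝ → E := fun x => α ⌈|x|⌉₊ x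
  have hg : ∀ n : ℕ, EqOn g (α n) (Ioo (-(n + 1 : ℝ)) (n + 1)) := by
    intro n x hx
    have hxg : x ∈ Ioo (-(⌈|x|⌉₊ + 1 : ℝ)) (⌈|x|⌉₊ + 1) :=
      abs_lt.1 ((Nat.le_ceil |x|).trans_lt (lt_add_one _))
    rcases le_total ⌈|x|⌉₊ n with hle | hle
    · exact hagree hle hxg
    · exact (hagree hle hx).symm
  refine ⟨g, by simpa using (hg 0 (by simp)).trans (hα₀ 0), fun x => ?_⟩
  obtain ⟨n, hn⟩ := exists_nat_gt |x|
  have hx : x ∈ Ioo (-(n + 1 : ℝ)) (n + 1) := abs_lt.1 (hn.trans (lt_add_one _))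
  rw [hg n hx]
  exact (hα n x hx).congr_of_eventuallyEq ((hg n).eventuallyEq_of_mem (Ioo_mem_nhds hx.1 hx.2))

end GlobalODE

/-- The term `s w` of the reduced equation for `s = λ h`, where `w` is the Riccati root at drift
`b - s`; negative `s` are replaced by `0` to obtain a globally Lipschitz function. -/
noncomputable def riccatiGrowth (A R b s : ℝ) : ℝ := max s 0 * riccatiRoot A R (b - max s 0)

section RiccatiGrowth

variable {A R b B : ℝ}

theorem continuous_riccatiGrowth {f g : ℝ → ℝ} (hf : Continuous f) (hg : Continuous g) :
    Continuous fun x => riccatiGrowth A R (f x) (g x) :=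
  (hg.max continuous_const).mul (continuous_riccatiRoot.comp (hf.sub (hg.max continuous_const)))

theorem riccatiGrowth_nonneg (hA : 0 < A) (hR : 0 < R) (b s : ℝ) : 0 ≤ riccatiGrowth A R b s :=
  mul_nonneg (le_max_right s 0) (riccatiRoot_pos hA hR _).le

theorem riccatiRoot_sub_max_le (hA : 0 < A) (hR : 0 < R) (hb : |b| ≤ B) (s : ℝ) :
    riccatiRoot A R (b - max s 0) ≤ riccatiRoot A R B :=
  monotone_riccatiRoot hA hR (by linarith [le_abs_self b, le_max_right s 0])

theorem riccatiGrowth_eq (hA : 0 < A) (hR : 0 < R) (b s : ℝ) :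
    riccatiGrowth A R b s = b * riccatiRoot A R (b - max s 0) + R
      - A * riccatiRoot A R (b - max s 0) ^ 2 := by
  have hdrift := riccatiDrift_riccatiRoot hA hR (b - max s 0)
  have hpos := riccatiRoot_pos hA hR (b - max s 0)
  unfold riccatiGrowth
  unfold riccatiDrift at hdrift
  field_simp at hdrift
  linear_combination hdrift

theorem riccatiGrowth_le (hA : 0 < A) (hR : 0 < R) (hb : |b| ≤ B) (s : ℝ) :
    riccatiGrowth A R b s ≤ B * riccatiRoot A R B + R := by
  have hmul : b * riccatiRoot A R (b - max s 0) ≤ B * riccatiRoot A R B :=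
    mul_le_mul ((le_abs_self b).trans hb) (riccatiRoot_sub_max_le hA hR hb s)
      (riccatiRoot_pos hA hR _).le ((abs_nonneg b).trans hb)
  have hsq : 0 ≤ A * riccatiRoot A R (b - max s 0) ^ 2 := by positivity
  rw [riccatiGrowth_eq hA hR]
  linarith

theorem abs_riccatiGrowth_sub_le (hA : 0 < A) (hR : 0 < R) (hb : |b| ≤ B) (s₁ s₂ : ℝ) :
    |riccatiGrowth A R b s₁ - riccatiGrowth A R b s₂| ≤
      (B + 2 * A * riccatiRoot A R B) / A * |s₁ - s₂| := by
  set w₁ := riccatiRoot A R (b - max s₁ 0)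
  set w₂ := riccatiRoot A R (b - max s₂ 0)
  have hroot : A * |w₁ - w₂| ≤ |s₁ - s₂| := by
    refine (mul_abs_riccatiRoot_sub_le hA hR _ _).trans ?_
    rw [sub_sub_sub_cancel_left, abs_sub_comm]
    exact abs_max_sub_max_le_abs s₁ s₂ 0
  have hfactor : |b - A * (w₁ + w₂)| ≤ B + 2 * A * riccatiRoot A R B := by
    have hw : A * (w₁ + w₂) ≤ A * (riccatiRoot A R B + riccatiRoot A R B) := by
      gcongr <;> exact riccatiRoot_sub_max_le hA hR hb _
    have hw₀ : 0 ≤ A * (w₁ + w₂) :=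
      mul_nonneg hA.le (add_pos (riccatiRoot_pos hA hR _) (riccatiRoot_pos hA hR _)).le
    rw [abs_le] at hb ⊢
    constructor <;> linarith
  calc |riccatiGrowth A R b s₁ - riccatiGrowth A R b s₂|
      = |b - A * (w₁ + w₂)| * |w₁ - w₂| := by
        rw [riccatiGrowth_eq hA hR, riccatiGrowth_eq hA hR, ← abs_mul]
        congr 1
        ring
    _ ≤ (B + 2 * A * riccatiRoot A R B) * (|s₁ - s₂| / A) := by
        gcongr
        · exact (abs_nonneg _).trans hfactor
        · rwa [le_div_iff₀' hA]
    _ = (B + 2 * A * riccatiRoot A R B) / A * |s₁ - s₂| := by ring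

theorem lipschitzWith_exp_mul_add_riccatiGrowth (hA : 0 < A) (hR : 0 < R) (hb : |b| ≤ B)
    (lam τ : ℝ) :
    LipschitzWith ((B + 2 * A * riccatiRoot A R B) / A).toNNReal fun y =>
      Real.exp τ * (lam + riccatiGrowth A R b (y * Real.exp (-τ))) := by
  refine LipschitzWith.of_dist_le_mul fun y₁ y₂ => ?_
  calc dist (Real.exp τ * _) (Real.exp τ * _)
      = Real.exp τ * |riccatiGrowth A R b (y₁ * Real.exp (-τ))
          - riccatiGrowth A R b (y₂ * Real.exp (-τ))| := by
        rw [Real.dist_eq, ← mul_sub, add_sub_add_left_eq_sub, abs_mul, Real.abs_exp]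
    _ ≤ Real.exp τ * ((B + 2 * A * riccatiRoot A R B) / A *
          |y₁ * Real.exp (-τ) - y₂ * Real.exp (-τ)|) := by
        gcongr
        exact abs_riccatiGrowth_sub_le hA hR hb _ _
    _ = (B + 2 * A * riccatiRoot A R B) / A * |y₁ - y₂| := by
        rw [← sub_mul, abs_mul, Real.abs_exp, Real.exp_neg]
        field_simp
    _ ≤ _ := mul_le_mul_of_nonneg_right (Real.le_coe_toNNReal _) (abs_nonneg _)

end RiccatiGrowth

section ReducedExistence

variable {A R : ℝ}

theorem exists_isIntegralCurve_riccatiGrowth (hA : 0 < A) (hR : 0 < R) (k r lam η : ℝ) :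
    ∃ g : ℝ → ℝ, g 0 = 0 ∧ IsIntegralCurve g fun t y =>
      Real.exp (η * t) * (lam + riccatiGrowth A R (k + r * t) (y * Real.exp (-(η * t)))) := by
  have hdrift : ∀ {T t : ℝ}, t ∈ Icc (-T) T → |k + r * t| ≤ |k| + |r| * T := fun ht =>
    (abs_add_le _ _).trans (by rw [abs_mul]; gcongr; exact abs_le.2 ht)
  refine exists_isIntegralCurve_of_bounded_lipschitz (fun y => ?_) (fun T => ?_) (fun T => ?_) 0
  · exact Continuous.mul (by fun_prop)
      ((continuous_riccatiGrowth (by fun_prop) (by fun_prop)).const_add lam)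
  · exact ⟨_, fun t ht => lipschitzWith_exp_mul_add_riccatiGrowth hA hR (hdrift ht) lam (η * t)⟩
  · set B := |k| + |r| * T
    refine ⟨(Real.exp (|η| * T) * (|lam| + (B * riccatiRoot A R B + R))).toNNReal,
      fun t ht y => le_trans ?_ (Real.le_coe_toNNReal _)⟩
    have hexp : η * t ≤ |η| * T := (le_abs_self _).trans <| by
      rw [abs_mul]; gcongr; exact abs_le.2 ht
    rw [norm_mul, Real.norm_eq_abs, Real.abs_exp]
    gcongr
    refine (norm_add_le _ _).trans (add_le_add_right ?_ _)
    rw [Real.norm_of_nonneg (riccatiGrowth_nonneg hA hR _ _)]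
    exact riccatiGrowth_le hA hR (hdrift ht) _

theorem exists_isReducedSolution (hA : 0 < A) (hR : 0 < R) (k r η : ℝ) {lam : ℝ}
    (hlam : 0 < lam) :
    ∃ w h : ℝ → ℝ, IsReducedSolution A R k r lam η w h ∧ Continuous w ∧ Continuous h ∧ h 0 = 0 := by
  obtain ⟨g, hg₀, hg⟩ := exists_isIntegralCurve_riccatiGrowth hA hR k r lam η
  have hgc : Continuous g := continuous_iff_continuousAt.2 fun x => (hg x).continuousAt
  have hmono : StrictMono g := strictMono_of_deriv_pos fun x => by
    rw [(hg x).deriv]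
    exact mul_pos (Real.exp_pos _) (add_pos_of_pos_of_nonneg hlam (riccatiGrowth_nonneg hA hR _ _))
  have hg_pos : ∀ x, 0 < x → 0 < g x := fun x hx => hg₀ ▸ hmono hx
  let h : ℝ → ℝ := fun x => g x * Real.exp (-(η * x)) / lam
  have hhc : Continuous h := by fun_prop
  have hlam_h : ∀ x, lam * h x = g x * Real.exp (-(η * x)) := fun x => mul_div_cancel₀ _ hlam.ne'
  have hh_pos : ∀ x, 0 < x → 0 < h x := fun x hx => by have := hg_pos x hx; positivity
  refine ⟨fun x => riccatiRoot A R (k + r * x - lam * h x), h,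
    ⟨fun x _ => riccatiRoot_pos hA hR _, hh_pos, fun x _ => riccatiDrift_riccatiRoot hA hR _,
      fun x hx => ?_⟩, continuous_riccatiRoot.comp (by fun_prop), hhc, by simp [h, hg₀]⟩
  have hexp : HasDerivAt (fun x => Real.exp (-(η * x))) (Real.exp (-(η * x)) * -(η * 1)) x :=
    ((hasDerivAt_id x).const_mul η).neg.exp
  refine (((hg x).mul hexp).div_const lam).congr_deriv ?_
  have hmax : max (g x * Real.exp (-(η * x))) 0 = lam * h x := by
    rw [hlam_h, max_eq_left (mul_nonneg (hg_pos x hx).le (Real.exp_pos _).le)]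
  have hinv : Real.exp (η * x) * Real.exp (-(η * x)) = 1 := by
    rw [← Real.exp_add, add_neg_cancel, Real.exp_zero]
  simp only [riccatiGrowth, hmax]
  rw [div_eq_iff hlam.ne']
  linear_combination (lam + lam * h x * riccatiRoot A R (k + r * x - lam * h x)) * hinv
    + η * hlam_h x

end ReducedExistence

/-- The expected drop `V(x) - E[V(x - S); S ≤ x]` of `V` at a claim `S` with distribution `F`. -/
noncomputable def expectedDrop (F : Measure ℝ) (V : ℝ → ℝ) (x : ℝ) : ℝ :=
  V x - ∫ s in Ioc 0 x, V (x - s) ∂F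

theorem expectedDrop_zero (F : Measure ℝ) (V : ℝ → ℝ) : expectedDrop F V 0 = V 0 := by
  simp [expectedDrop]

section ExponentialClaims

open ProbabilityTheory

variable {η : ℝ} {V : ℝ → ℝ}

theorem setIntegral_expMeasure_comp_sub (hη : 0 < η) (V : ℝ → ℝ) {x : ℝ} (hx : 0 ≤ x) :
    ∫ s in Ioc 0 x, V (x - s) ∂(expMeasure η) =
      η * Real.exp (-(η * x)) * ∫ y in (0 : ℝ)..x, V y * Real.exp (η * y) := by
  have hmeas : Measurable (exponentialPDF η) :=
    (measurable_exponentialPDFReal η).ennreal_ofReal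
  calc ∫ s in Ioc 0 x, V (x - s) ∂(expMeasure η)
      = ∫ s in Ioc 0 x, (exponentialPDF η s).toReal • V (x - s) :=
        setIntegral_withDensity_eq_setIntegral_toReal_smul hmeas
          (ae_of_all _ fun _ => ENNReal.ofReal_lt_top) _ measurableSet_Ioc
    _ = ∫ s in Ioc 0 x, η * Real.exp (-(η * x)) * (V (x - s) * Real.exp (η * (x - s))) := by
        refine setIntegral_congr_fun measurableSet_Ioc fun s hs => ?_
        have hexp : Real.exp (-(η * s)) = Real.exp (-(η * x)) * Real.exp (η * (x - s)) := by
          rw [← Real.exp_add]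
          ring_nf
        simp only [smul_eq_mul]
        rw [exponentialPDF_of_nonneg hs.1.le, ENNReal.toReal_ofReal (by positivity), hexp]
        ring
    _ = _ := by
        rw [← intervalIntegral.integral_of_le hx, intervalIntegral.integral_const_mul,
          intervalIntegral.integral_comp_sub_left (fun y => V y * Real.exp (η * y)) x]
        simp only [sub_self, sub_zero]

theorem eqOn_expectedDrop_expMeasure (hη : 0 < η) (V : ℝ → ℝ) :
    EqOn (expectedDrop (expMeasure η) V) (fun x => V x -
      η * Real.exp (-(η * x)) * ∫ y in (0 : ℝ)..x, V y * Real.exp (η * y)) (Ici 0) :=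
  fun x (hx : 0 ≤ x) => by rw [expectedDrop, setIntegral_expMeasure_comp_sub hη V hx]

theorem continuousOn_expectedDrop_expMeasure (hη : 0 < η) {b : ℝ} (hV : ContinuousOn V (Icc 0 b)) :
    ContinuousOn (expectedDrop (expMeasure η) V) (Icc 0 b) := by
  rcases lt_or_ge b 0 with hb | hb
  · simp [Icc_eq_empty hb.not_ge]
  have hprim : ContinuousOn (fun x => ∫ y in (0 : ℝ)..x, V y * Real.exp (η * y)) (Icc 0 b) := by
    rw [← uIcc_of_le hb] at hV ⊢
    exact intervalIntegral.continuousOn_primitive_interval'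
      (ContinuousOn.intervalIntegrable (by fun_prop)) left_mem_uIcc
  exact ContinuousOn.congr (by fun_prop)
    ((eqOn_expectedDrop_expMeasure hη V).mono Icc_subset_Ici_self)

theorem hasDerivAt_expectedDrop_expMeasure (hη : 0 < η) (hV : ContinuousOn V (Ici 0)) {u x : ℝ}
    (hx : 0 < x) (hu : HasDerivAt V u x) :
    HasDerivAt (expectedDrop (expMeasure η) V) (u - η * expectedDrop (expMeasure η) V x) x := by
  have hcont : ContinuousOn (fun y => V y * Real.exp (η * y)) (Ici 0) := by fun_prop
  have hprim : HasDerivAt (fun x => ∫ y in (0 : ℝ)..x, V y * Real.exp (η * y))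
      (V x * Real.exp (η * x)) x :=
    intervalIntegral.integral_hasDerivAt_right
      ((hcont.mono (uIcc_of_le hx.le ▸ Icc_subset_Ici_self)).intervalIntegrable)
      ((hcont.mono Ioi_subset_Ici_self).stronglyMeasurableAtFilter isOpen_Ioi x hx)
      (hcont.continuousAt (Ici_mem_nhds hx))
  have hexp : HasDerivAt (fun x => Real.exp (-(η * x))) (Real.exp (-(η * x)) * -(η * 1)) x :=
    ((hasDerivAt_id x).const_mul η).neg.exp
  have hinv : Real.exp (-(η * x)) * Real.exp (η * x) = 1 := by
    rw [← Real.exp_add, neg_add_cancel, Real.exp_zero]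
  refine ((hu.sub ((hexp.const_mul η).mul hprim)).congr_of_eventuallyEq
    ((eqOn_expectedDrop_expMeasure hη V).eventuallyEq_of_mem (Ici_mem_nhds hx))).congr_deriv ?_
  rw [eqOn_expectedDrop_expMeasure hη V hx.le]
  linear_combination -η * V x * hinv

end ExponentialClaims

/-- The Arrow–Pratt absolute risk aversion `-V'' / V'`. -/
noncomputable def absRiskAversion (V : ℝ → ℝ) (x : ℝ) : ℝ := -deriv (deriv V) x / deriv V x

/-- The utility function with absolute risk aversion `w`, normalized to have value `0` and slope
`1` at the origin. -/
noncomputable def utilityOfRiskAversion (w : ℝ → ℝ) (x : ℝ) : ℝ :=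
  ∫ y in (0 : ℝ)..x, Real.exp (-∫ z in (0 : ℝ)..y, w z)

section UtilityOfRiskAversion

variable {w : ℝ → ℝ}

theorem hasDerivAt_exp_neg_integral (hw : Continuous w) (x : ℝ) :
    HasDerivAt (fun x => Real.exp (-∫ z in (0 : ℝ)..x, w z))
      (Real.exp (-∫ z in (0 : ℝ)..x, w z) * -w x) x :=
  (hw.integral_hasStrictDerivAt 0 x).hasDerivAt.neg.exp

theorem hasDerivAt_utilityOfRiskAversion (hw : Continuous w) (x : ℝ) :
    HasDerivAt (utilityOfRiskAversion w) (Real.exp (-∫ z in (0 : ℝ)..x, w z)) x := by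
  have hcont : Continuous fun x => Real.exp (-∫ z in (0 : ℝ)..x, w z) :=
    continuous_iff_continuousAt.2 fun x => (hasDerivAt_exp_neg_integral hw x).continuousAt
  exact (hcont.integral_hasStrictDerivAt 0 x).hasDerivAt

theorem deriv_utilityOfRiskAversion (hw : Continuous w) :
    deriv (utilityOfRiskAversion w) = fun x => Real.exp (-∫ z in (0 : ℝ)..x, w z) :=
  funext fun x => (hasDerivAt_utilityOfRiskAversion hw x).deriv

theorem hasDerivAt_deriv_utilityOfRiskAversion (hw : Continuous w) (x : ℝ) :
    HasDerivAt (deriv (utilityOfRiskAversion w)) (deriv (utilityOfRiskAversion w) x * -w x) x := by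
  rw [deriv_utilityOfRiskAversion hw]
  exact hasDerivAt_exp_neg_integral hw x

theorem deriv_utilityOfRiskAversion_pos (hw : Continuous w) (x : ℝ) :
    0 < deriv (utilityOfRiskAversion w) x := by
  rw [deriv_utilityOfRiskAversion hw]
  exact Real.exp_pos _

theorem contDiff_two_utilityOfRiskAversion (hw : Continuous w) :
    ContDiff ℝ 2 (utilityOfRiskAversion w) := by
  have hdiff : Differentiable ℝ (deriv (utilityOfRiskAversion w)) := fun x =>
    (hasDerivAt_deriv_utilityOfRiskAversion hw x).differentiableAt
  have hderiv₂ : deriv (deriv (utilityOfRiskAversion w)) = fun x =>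
      deriv (utilityOfRiskAversion w) x * -w x :=
    funext fun x => (hasDerivAt_deriv_utilityOfRiskAversion hw x).deriv
  rw [← one_add_one_eq_two, contDiff_succ_iff_deriv, contDiff_one_iff_deriv, hderiv₂]
  exact ⟨fun x => (hasDerivAt_utilityOfRiskAversion hw x).differentiableAt, by simp, hdiff,
    hdiff.continuous.mul hw.neg⟩

theorem absRiskAversion_utilityOfRiskAversion (hw : Continuous w) :
    absRiskAversion (utilityOfRiskAversion w) = w := by
  funext x
  rw [absRiskAversion, (hasDerivAt_deriv_utilityOfRiskAversion hw x).deriv, mul_neg, neg_neg,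
    mul_div_cancel_left₀ _ (deriv_utilityOfRiskAversion_pos hw x).ne']

end UtilityOfRiskAversion

namespace SurplusModel

open ProbabilityTheory

variable (P : SurplusModel)

/-- The coefficient `(1 - ρ²)σ₁²/2` of `V''` left after hedging with the optimal investment. -/
noncomputable def residualVariance : ℝ := (1 - P.ρ ^ 2) * P.σ₁ ^ 2 / 2

/-- The premium rate corrected by the excess return of the variance-minimizing investment
`-ρσ₁/σ`. -/
noncomputable def hedgedPremium : ℝ := P.c - (P.μ - P.r) * P.ρ * P.σ₁ / P.σ

/-- Half of the squared Sharpe ratio `(μ - r)/σ` of the stock. -/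
noncomputable def halfSqSharpe : ℝ := (P.μ - P.r) ^ 2 / (2 * P.σ ^ 2)

variable {P} {F : Measure ℝ} {V : ℝ → ℝ} {x η : ℝ}

theorem residualVariance_pos (hσ₁ : P.σ₁ ≠ 0) (hρ : |P.ρ| < 1) : 0 < P.residualVariance := by
  have hcorr : 0 < 1 - P.ρ ^ 2 := sub_pos.2 ((sq_lt_one_iff_abs_lt_one P.ρ).2 hρ)
  unfold residualVariance
  positivity

theorem halfSqSharpe_pos (hσ : P.σ ≠ 0) (hμr : P.μ ≠ P.r) : 0 < P.halfSqSharpe :=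
  div_pos (sq_pos_of_ne_zero (sub_ne_zero.2 hμr)) (by positivity)

theorem halfSqSharpe_nonneg (P : SurplusModel) : 0 ≤ P.halfSqSharpe := by
  unfold halfSqSharpe
  positivity

theorem optimalInvestment_eq (P : SurplusModel) (V : ℝ → ℝ) (x : ℝ) :
    P.optimalInvestment V x =
      (P.μ - P.r) / P.σ ^ 2 * (absRiskAversion V x)⁻¹ - P.ρ * (P.σ₁ / P.σ) := by
  unfold optimalInvestment absRiskAversion
  rw [inv_div, div_neg, neg_div, mul_neg, div_mul_div_comm]

theorem jumpTerm_eq (P : SurplusModel) (F : Measure ℝ) (V : ℝ → ℝ) (x : ℝ) :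
    P.jumpTerm F V x = P.lam * expectedDrop F V x :=
  rfl

theorem generator_eq_add_sq (hσ : P.σ ≠ 0) (hV : deriv V x ≠ 0) (hV' : deriv (deriv V) x ≠ 0)
    (a : ℝ) :
    P.generator F a V x =
      deriv V x * (P.hedgedPremium + P.r * x - P.lam * (expectedDrop F V x / deriv V x)
          - riccatiDrift P.residualVariance P.halfSqSharpe (absRiskAversion V x))
        + P.σ ^ 2 / 2 * deriv (deriv V) x * (a - P.optimalInvestment V x) ^ 2 := by
  rw [generator, jumpTerm_eq]
  unfold riccatiDrift residualVariance hedgedPremium halfSqSharpe optimalInvestment absRiskAversion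
  field_simp
  ring

theorem generator_lt_generator_optimalInvestment (hσ : P.σ ≠ 0) (hV : deriv V x ≠ 0)
    (hV' : deriv (deriv V) x < 0) {a : ℝ} (ha : a ≠ P.optimalInvestment V x) :
    P.generator F a V x < P.generator F (P.optimalInvestment V x) V x := by
  rw [generator_eq_add_sq hσ hV hV'.ne, generator_eq_add_sq hσ hV hV'.ne]
  have hsq : 0 < (a - P.optimalInvestment V x) ^ 2 := by
    have := sub_ne_zero.2 ha
    positivity
  have hconcave : P.σ ^ 2 / 2 * deriv (deriv V) x < 0 :=
    mul_neg_of_pos_of_neg (by positivity) hV'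
  rw [sub_self, zero_pow two_ne_zero, mul_zero, add_zero]
  exact add_lt_of_neg_right _ (mul_neg_of_neg_of_pos hconcave hsq)

theorem isGreatest_generator (hσ : P.σ ≠ 0) (hV : deriv V x ≠ 0) (hV' : deriv (deriv V) x < 0) :
    IsGreatest (range fun a : ℝ => P.generator F a V x)
      (P.generator F (P.optimalInvestment V x) V x) := by
  refine ⟨⟨_, rfl⟩, ?_⟩
  rintro _ ⟨a, rfl⟩
  rcases eq_or_ne a (P.optimalInvestment V x) with rfl | ha
  · exact le_rfl
  · exact (generator_lt_generator_optimalInvestment hσ hV hV' ha).le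

theorem isLUB_generator_iff (hσ : P.σ ≠ 0) (hV : deriv V x ≠ 0) (hV' : deriv (deriv V) x < 0) :
    IsLUB (range fun a : ℝ => P.generator F a V x) 0 ↔
      riccatiDrift P.residualVariance P.halfSqSharpe (absRiskAversion V x) =
        P.hedgedPremium + P.r * x - P.lam * (expectedDrop F V x / deriv V x) := by
  have hvalue := generator_eq_add_sq (F := F) hσ hV hV'.ne (P.optimalInvestment V x)
  rw [sub_self, zero_pow two_ne_zero, mul_zero, add_zero] at hvalue
  have hzero : P.generator F (P.optimalInvestment V x) V x = 0 ↔
      riccatiDrift P.residualVariance P.halfSqSharpe (absRiskAversion V x) =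
        P.hedgedPremium + P.r * x - P.lam * (expectedDrop F V x / deriv V x) := by
    rw [hvalue, mul_eq_zero, or_iff_right hV, sub_eq_zero, eq_comm]
  rw [← hzero]
  have hmax := (isGreatest_generator (F := F) hσ hV hV').isLUB
  exact ⟨hmax.unique, fun h => h ▸ hmax⟩

namespace IsHJBSolution

theorem hasDerivAt (hV : P.IsHJBSolution F V) (hx : 0 < x) : HasDerivAt V (deriv V x) x :=
  ((hV.contDiffOn.contDiffAt (Ioi_mem_nhds hx)).differentiableAt two_ne_zero).hasDerivAt

theorem hasDerivAt_deriv (hV : P.IsHJBSolution F V) (hx : 0 < x) :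
    HasDerivAt (deriv V) (deriv (deriv V) x) x := by
  have hC2 : ContDiffOn ℝ (1 + 1) V (Ioi 0) := one_add_one_eq_two (R := WithTop ℕ∞) ▸ hV.contDiffOn
  have hC1 := ((contDiffOn_succ_iff_deriv_of_isOpen isOpen_Ioi).1 hC2).2.2
  exact ((hC1.contDiffAt (Ioi_mem_nhds hx)).differentiableAt one_ne_zero).hasDerivAt

theorem absRiskAversion_pos (hV : P.IsHJBSolution F V) (hx : 0 < x) : 0 < absRiskAversion V x :=
  div_pos (neg_pos.2 (hV.deriv_deriv_neg x hx)) (hV.deriv_pos x hx)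

theorem expectedDrop_pos (hV : P.IsHJBSolution (expMeasure η) V) (hη : 0 < η) (hx : 0 < x) :
    0 < expectedDrop (expMeasure η) V x := by
  obtain ⟨y, hy, hdrop⟩ := exists_eq_mul_exp_mul_of_relaxation hx
    (continuousOn_expectedDrop_expMeasure hη (hV.continuousOn.mono Icc_subset_Ici_self))
    (by rw [expectedDrop_zero, hV.zero])
    fun y hy => hasDerivAt_expectedDrop_expMeasure hη hV.continuousOn hy.1 (hV.hasDerivAt hy.1)
  rw [hdrop]
  exact mul_pos (by positivity) (hV.deriv_pos y hy.1)

theorem isReducedSolution (hV : P.IsHJBSolution (expMeasure η) V) (hσ : P.σ ≠ 0) (hη : 0 < η) :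
    IsReducedSolution P.residualVariance P.halfSqSharpe P.hedgedPremium P.r P.lam η
      (absRiskAversion V) fun x => expectedDrop (expMeasure η) V x / deriv V x where
  pos_left _ hx := hV.absRiskAversion_pos hx
  pos_right x hx := div_pos (hV.expectedDrop_pos hη hx) (hV.deriv_pos x hx)
  riccatiDrift_eq x hx :=
    (isLUB_generator_iff hσ (hV.deriv_pos x hx).ne' (hV.deriv_deriv_neg x hx)).1 (hV.hjb x hx)
  hasDerivAt_right x hx := by
    have hpos := hV.deriv_pos x hx
    refine ((hasDerivAt_expectedDrop_expMeasure hη hV.continuousOn hx (hV.hasDerivAt hx)).div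
      (hV.hasDerivAt_deriv hx) hpos.ne').congr_deriv ?_
    unfold absRiskAversion
    field_simp
    ring

theorem tendsto_mul_absRiskAversion_sub (hV : P.IsHJBSolution (expMeasure η) V) (hr : 0 < P.r)
    (hσ : P.σ ≠ 0) (hσ₁ : P.σ₁ ≠ 0) (hlam : 0 < P.lam) (hρ : |P.ρ| < 1) (hη : 0 < η) :
    Tendsto (fun x => x * (absRiskAversion V x - η)) atTop (𝓝 (1 - P.lam / P.r)) :=
  (hV.isReducedSolution hσ hη).tendsto_mul_sub (residualVariance_pos hσ₁ hρ)
    P.halfSqSharpe_nonneg hr hlam hη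

theorem tendsto_mul_optimalInvestment_sub {m : ℝ} (hV : P.IsHJBSolution (expMeasure (1 / m)) V)
    (hr : 0 < P.r) (hσ : P.σ ≠ 0) (hσ₁ : P.σ₁ ≠ 0) (hlam : 0 < P.lam) (hρ : |P.ρ| < 1)
    (hm : 0 < m) :
    Tendsto (fun x => x * (P.optimalInvestment V x - P.limitInvestment m)) atTop
      (𝓝 (-P.rateCoeff m)) := by
  have hw := hV.tendsto_mul_absRiskAversion_sub hr hσ hσ₁ hlam hρ (one_div_pos.2 hm)
  have hlim := (hw.const_mul (-((P.μ - P.r) * m / P.σ ^ 2))).div (tendsto_of_tendsto_mul_sub hw)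
    (one_div_pos.2 hm).ne'
  have hvalue : -((P.μ - P.r) * m / P.σ ^ 2) * (1 - P.lam / P.r) / (1 / m) = -P.rateCoeff m := by
    unfold rateCoeff
    field_simp
  rw [hvalue] at hlim
  refine hlim.congr' ?_
  filter_upwards [eventually_gt_atTop 0] with x hx
  have hpos := hV.absRiskAversion_pos hx
  simp only [optimalInvestment_eq, limitInvestment, Pi.div_apply]
  field_simp
  ring

end IsHJBSolution

theorem rateCoeff_ne_zero {m : ℝ} (hr : P.r ≠ 0) (hσ : P.σ ≠ 0) (hμr : P.μ ≠ P.r)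
    (hlr : P.lam ≠ P.r) (hm : m ≠ 0) : P.rateCoeff m ≠ 0 := by
  have hfactor : 1 - P.lam / P.r ≠ 0 := by
    rw [one_sub_div hr]
    exact div_ne_zero (sub_ne_zero.2 hlr.symm) hr
  exact mul_ne_zero hfactor
    (div_ne_zero (mul_ne_zero (sub_ne_zero.2 hμr) (pow_ne_zero 2 hm)) (pow_ne_zero 2 hσ))

end SurplusModel

theorem IsReducedSolution.expectedDrop_utilityOfRiskAversion {A R k r lam η : ℝ} {w h : ℝ → ℝ}
    (hS : IsReducedSolution A R k r lam η w h) (hη : 0 < η) (hw : Continuous w)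
    (hh : Continuous h) (hh₀ : h 0 = 0) {x : ℝ} (hx : 0 < x) :
    expectedDrop (ProbabilityTheory.expMeasure η) (utilityOfRiskAversion w) x =
      h x * deriv (utilityOfRiskAversion w) x := by
  have hV := (contDiff_two_utilityOfRiskAversion hw).continuous
  have hV' : Continuous (deriv (utilityOfRiskAversion w)) :=
    (contDiff_two_utilityOfRiskAversion hw).continuous_deriv one_le_two
  -- The difference `f` of both sides solves `f' = -η f`.
  obtain ⟨y, -, hdiff⟩ := exists_eq_mul_exp_mul_of_relaxation (p := 0) (η := η) hx
    ((continuousOn_expectedDrop_expMeasure hη hV.continuousOn).sub (hh.mul hV').continuousOn)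
    (by simp [expectedDrop_zero, hh₀, utilityOfRiskAversion]) fun y hy => by
      refine ((hasDerivAt_expectedDrop_expMeasure hη hV.continuousOn hy.1
        (hasDerivAt_utilityOfRiskAversion hw y)).sub ((hS.hasDerivAt_right y hy.1).mul
        (hasDerivAt_deriv_utilityOfRiskAversion hw y))).congr_deriv ?_
      simp only [Pi.zero_apply, Pi.sub_apply, Pi.mul_apply, deriv_utilityOfRiskAversion hw]
      ring
  simpa [sub_eq_zero] using hdiff

namespace SurplusModel

open ProbabilityTheory

variable {P : SurplusModel} {η : ℝ}

theorem isHJBSolution_utilityOfRiskAversion {w h : ℝ → ℝ}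
    (hS : IsReducedSolution P.residualVariance P.halfSqSharpe P.hedgedPremium P.r P.lam η w h)
    (hσ : P.σ ≠ 0) (hη : 0 < η) (hw : Continuous w) (hh : Continuous h) (hh₀ : h 0 = 0) :
    P.IsHJBSolution (expMeasure η) (utilityOfRiskAversion w) := by
  have hpos := deriv_utilityOfRiskAversion_pos hw
  have hneg : ∀ x, 0 < x → deriv (deriv (utilityOfRiskAversion w)) x < 0 := fun x hx => by
    rw [(hasDerivAt_deriv_utilityOfRiskAversion hw x).deriv]
    exact mul_neg_of_pos_of_neg (hpos x) (neg_lt_zero.2 (hS.pos_left x hx))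
  have hC2 := contDiff_two_utilityOfRiskAversion hw
  have hslope : deriv (utilityOfRiskAversion w) 0 = 1 := by simp [deriv_utilityOfRiskAversion hw]
  refine ⟨hC2.contDiffOn, hC2.continuous.continuousOn, fun x _ => hpos x, hneg,
    intervalIntegral.integral_same, ?_, fun x hx => ?_⟩
  · exact hslope ▸ ((hC2.continuous_deriv one_le_two).tendsto 0).mono_left nhdsWithin_le_nhds
  · rw [isLUB_generator_iff hσ (hpos x).ne' (hneg x hx), absRiskAversion_utilityOfRiskAversion hw,
      hS.expectedDrop_utilityOfRiskAversion hη hw hh hh₀ hx, mul_div_cancel_right₀ _ (hpos x).ne',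
      hS.riccatiDrift_eq x hx]

theorem exists_isHJBSolution (hσ : P.σ ≠ 0) (hσ₁ : P.σ₁ ≠ 0) (hlam : 0 < P.lam)
    (hρ : |P.ρ| < 1) (hμr : P.μ ≠ P.r) (hη : 0 < η) :
    ∃ V : ℝ → ℝ, P.IsHJBSolution (expMeasure η) V := by
  obtain ⟨w, h, hS, hw, hh, hh₀⟩ := exists_isReducedSolution (residualVariance_pos hσ₁ hρ)
    (halfSqSharpe_pos hσ hμr) P.hedgedPremium P.r η hlam
  exact ⟨_, isHJBSolution_utilityOfRiskAversion hS hσ hη hw hh hh₀⟩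

end SurplusModel

theorem mainTheorem6 (P : SurplusModel) (m : ℝ)
    (hc : 0 < P.c) (hr : 0 < P.r) (hμ : 0 < P.μ) (hσ : 0 < P.σ) (hσ₁ : 0 < P.σ₁)
    (hlam : 0 < P.lam) (hρ : |P.ρ| < 1) (hμr : P.μ ≠ P.r) (hm : 0 < m) :
    (∃ V : ℝ → ℝ, P.IsHJBSolution (ProbabilityTheory.expMeasure (1 / m)) V) ∧
    ∀ V : ℝ → ℝ, P.IsHJBSolution (ProbabilityTheory.expMeasure (1 / m)) V →
      -- the optimal investment is the unique maximizer in the HJB equation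
      (∀ x, 0 < x → ∀ a : ℝ, a ≠ P.optimalInvestment V x →
        P.generator (ProbabilityTheory.expMeasure (1 / m)) a V x <
          P.generator (ProbabilityTheory.expMeasure (1 / m)) (P.optimalInvestment V x) V x) ∧
      -- finite limit
      Tendsto (P.optimalInvestment V) atTop (𝓝 (P.limitInvestment m)) ∧
      -- expansion up to `o(1/x)`
      (fun x => P.optimalInvestment V x - (P.limitInvestment m - P.rateCoeff m * (1 / x)))
        =o[atTop] (fun x : ℝ => 1 / x) ∧
      -- multiplicative form of the same expansion when the coefficient of `1/x` is nonzero
      (P.lam ≠ P.r → ∃ ε : ℝ → ℝ, Tendsto ε atTop (𝓝 0) ∧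
        ∀ x, 0 < x → P.optimalInvestment V x =
          P.limitInvestment m - P.rateCoeff m * (1 / x) * (1 + ε x)) := by
  refine ⟨SurplusModel.exists_isHJBSolution hσ.ne' hσ₁.ne' hlam hρ hμr (one_div_pos.2 hm),
    fun V hV => ?_⟩
  have hrate := hV.tendsto_mul_optimalInvestment_sub hr hσ.ne' hσ₁.ne' hlam hρ hm
  refine ⟨fun x hx a ha => ?_, ?_, ?_, fun hlr => ?_⟩
  · exact SurplusModel.generator_lt_generator_optimalInvestment hσ.ne' (hV.deriv_pos x hx).ne'
      (hV.deriv_deriv_neg x hx) ha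
  · exact tendsto_of_tendsto_mul_sub hrate
  · exact isLittleO_sub_of_tendsto_mul_sub hrate
  · exact exists_eq_sub_mul_one_add_of_tendsto_mul_sub
      (SurplusModel.rateCoeff_ne_zero hr.ne' hσ.ne' hμr hlr hm.ne') hrate
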